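/- Let $H$ be a separable real or complex Hilbert space and let $A$ be a bounded self-adjoint operator on $H$ with $\inf_{\|x\|=1}\langle Ax,x\rangle>0$. For $\psi\in H$ let $\mu_\psi$ be the spectral measure of $A$ at $\psi$, that is, the finite Borel measure on the spectrum $\sigma(A)\subset\mathbb{R}$ with $\langle\psi,f(A)\psi\rangle=\int_{\sigma(A)} f\,d\mu_\psi$ for all continuous $f$ on $\sigma(A)$. Let $H_{ac}$ (respectively $H_{sc}$) be the closed subspace of all $\psi$ for which $\mu_\psi$ is absolutely continuous (respectively atomless and singular) with respect to Lebesgue measure, put $H_{cont}=H_{ac}\oplus H_{sc}$, which is invariant under $A$, and let $\sigma_{cont}=\sigma(A|_{H_{cont}})$. If $\sigma_{cont}\neq\emptyset$, then the ellipsoid $$E=\{x\in H:\ \langle x,Ax\rangle\le 1\}$$ generated by $A$ is not linearly expand-contract plastic (LEC-plastic): there is a linear operator $T:H\to H$ that maps $E$ bijectively onto $E$ and satisfies $\|Tx-Ty\|\le\|x-y\|$ for all $x,y\in E$, but for which $\|Tx-Ty\|<\|x-y\|$ for some $x,y\in E$. -/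

import Mathlib

open MeasureTheory

noncomputable section

namespace LECPlastic

section Plastic

/-- Linear expand-contract plasticity of a subset `M` of a normed space `X`: every linear operator
`T : X → X` whose restriction to `M` is a non-expansive bijection of `M` onto `M` is an isometry
on `M`. -/
def IsLECPlastic (𝕜 : Type*) [RCLike 𝕜] {X : Type*} [NormedAddCommGroup X] [NormedSpace 𝕜 X]
    (M : Set X) : Prop :=
  ∀ T : X →ₗ[𝕜] X, Set.BijOn T M M →
    (∀ x ∈ M, ∀ y ∈ M, dist (T x) (T y) ≤ dist x y) →
    ∀ x ∈ M, ∀ y ∈ M, dist (T x) (T y) = dist x y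

end Plastic

section Hilbert

variable {𝕜 : Type*} [RCLike 𝕜] {H : Type*} [NormedAddCommGroup H] [InnerProductSpace 𝕜 H]

/-- The ellipsoid `{x | ⟨x, A x⟩ ≤ 1}`. The inner product is a real number for self-adjoint `A`. -/
def ellipsoid (A : H →L[𝕜] H) : Set H :=
  {x | RCLike.re (inner 𝕜 x (A x)) ≤ 1}

/-- The spectrum of `A`, as a subset of the real line (all of the spectrum if `A` is
self-adjoint). -/
def realSpectrum (A : H →L[𝕜] H) : Set ℝ :=
  {t | (t : 𝕜) ∈ spectrum 𝕜 A}

/-- The function `f(t) = t` on the spectrum of `A`. -/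
def spectrumId (A : H →L[𝕜] H) : C(realSpectrum A, 𝕜) where
  toFun t := ((t : ℝ) : 𝕜)
  continuous_toFun := RCLike.continuous_ofReal.comp continuous_subtype_val

variable [CompleteSpace H]

/-- `φ` is the continuous functional calculus `f ↦ f(A)` of `A`: the unique continuous unital
`*`-homomorphism from the continuous functions on the spectrum to the bounded operators that sends
the function `t ↦ t` to `A`. -/
structure IsFunctionalCalculus (A : H →L[𝕜] H)
    (φ : C(realSpectrum A, 𝕜) →⋆ₐ[𝕜] (H →L[𝕜] H)) : Prop where
  continuous : Continuous φ
  map_id : φ (spectrumId A) = A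

/-- `μ` is the spectral measure of `A` associated with the vector `ψ`: the unique finite Borel
measure on the spectrum of `A` with `⟨ψ, f(A) ψ⟩ = ∫ f dμ` for every continuous `f`. -/
structure IsSpectralMeasure (A : H →L[𝕜] H) (ψ : H) (μ : Measure (realSpectrum A)) : Prop where
  finite : IsFiniteMeasure μ
  inner_eq : ∃ φ : C(realSpectrum A, 𝕜) →⋆ₐ[𝕜] (H →L[𝕜] H), IsFunctionalCalculus A φ ∧
    ∀ f : C(realSpectrum A, 𝕜), inner 𝕜 ψ (φ f ψ) = ∫ t, f t ∂μ

/-- The vectors whose spectral measure, seen as a measure on the real line, is absolutely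
continuous with respect to Lebesgue measure. -/
def acVectors (A : H →L[𝕜] H) : Set H :=
  {ψ | ∃ μ : Measure (realSpectrum A), IsSpectralMeasure A ψ μ ∧
    μ.map (Subtype.val : realSpectrum A → ℝ) ≪ volume}

/-- The vectors whose spectral measure, seen as a measure on the real line, is singularly
continuous: without atoms and singular with respect to Lebesgue measure. -/
def scVectors (A : H →L[𝕜] H) : Set H :=
  {ψ | ∃ μ : Measure (realSpectrum A), IsSpectralMeasure A ψ μ ∧
    (∀ t : ℝ, μ.map (Subtype.val : realSpectrum A → ℝ) {t} = 0) ∧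
    μ.map (Subtype.val : realSpectrum A → ℝ) ⟂ₘ volume}

/-- The continuous subspace `H_cont = H_ac ⊕ H_sc` of `A`. For self-adjoint `A` the two sets of
vectors are themselves closed subspaces, orthogonal to each other, so that taking spans adds
nothing to them. -/
def contSubspace (A : H →L[𝕜] H) : Submodule 𝕜 H :=
  Submodule.span 𝕜 (acVectors A) ⊔ Submodule.span 𝕜 (scVectors A)

/-- The spectral measure of `A ψ` has a density with respect to that of `ψ`. -/
theorem IsSpectralMeasure.apply {A : H →L[𝕜] H} {ψ : H} {μ : Measure (realSpectrum A)}
    (h : IsSpectralMeasure A ψ μ) :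
    ∃ ν : Measure (realSpectrum A), IsSpectralMeasure A (A ψ) ν ∧ ν ≪ μ := by
  obtain ⟨hfin, φ, hφ, hint⟩ := h
  have hm : Measurable fun t : realSpectrum A => ENNReal.ofReal ((t : ℝ) ^ 2) := by fun_prop
  refine ⟨μ.withDensity fun t => ENNReal.ofReal ((t : ℝ) ^ 2), ⟨?_, φ, hφ, fun f => ?_⟩,
    withDensity_absolutelyContinuous _ _⟩
  · refine isFiniteMeasure_withDensity (ne_of_lt ?_)
    refine lt_of_le_of_lt (lintegral_mono (g := fun _ =>
      ENNReal.ofReal ((‖A‖ * ‖(1 : H →L[𝕜] H)‖) ^ 2)) fun t => ?_) ?_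
    · refine ENNReal.ofReal_le_ofReal ?_
      have ht : ‖((t : ℝ) : 𝕜)‖ ≤ ‖A‖ * ‖(1 : H →L[𝕜] H)‖ :=
        spectrum.norm_le_norm_mul_of_mem t.2
      rw [RCLike.norm_ofReal] at ht
      exact sq_le_sq' (neg_le_of_abs_le ht) (le_of_abs_le ht)
    · rw [lintegral_const]
      exact ENNReal.mul_lt_top ENNReal.ofReal_lt_top (measure_lt_top μ _)
  · have hstar : star (spectrumId A) = spectrumId A := by
      ext t
      simp [spectrumId]
    have hadj : ContinuousLinearMap.adjoint A = A := by
      rw [← ContinuousLinearMap.star_eq_adjoint]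
      conv_lhs => rw [← hφ.map_id, ← map_star, hstar, hφ.map_id]
    have h1 : inner 𝕜 (A ψ) (φ f (A ψ)) = inner 𝕜 ψ (φ (spectrumId A * f * spectrumId A) ψ) := by
      rw [map_mul, map_mul, hφ.map_id]
      change _ = inner 𝕜 ψ (A (φ f (A ψ)))
      rw [← ContinuousLinearMap.adjoint_inner_left A, hadj]
    rw [h1, hint, integral_withDensity_eq_integral_toReal_smul hm (by simp)]
    refine integral_congr_ae (Filter.Eventually.of_forall fun t => ?_)
    simp only [ContinuousMap.mul_apply, spectrumId, ContinuousMap.coe_mk,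
      ENNReal.toReal_ofReal (sq_nonneg (t : ℝ)), RCLike.real_smul_eq_coe_mul]
    push_cast
    ring

/-- The continuous subspace is invariant under `A`. -/
theorem mapsTo_contSubspace (A : H →L[𝕜] H) :
    ∀ x ∈ contSubspace A, A x ∈ contSubspace A := by
  have hac : acVectors A ⊆ A ⁻¹' acVectors A := by
    rintro ψ ⟨μ, hμ, hvol⟩
    obtain ⟨ν, hν, hνμ⟩ := hμ.apply
    exact ⟨ν, hν, (hνμ.map measurable_subtype_coe).trans hvol⟩
  have hsc : scVectors A ⊆ A ⁻¹' scVectors A := by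
    rintro ψ ⟨μ, hμ, hat, hvol⟩
    obtain ⟨ν, hν, hνμ⟩ := hμ.apply
    have hmap := hνμ.map (f := (Subtype.val : realSpectrum A → ℝ)) measurable_subtype_coe
    exact ⟨ν, hν, fun t => hmap (hat t),
      hvol.mono_ac hmap Measure.AbsolutelyContinuous.rfl⟩
  have key : contSubspace A ≤ (contSubspace A).comap (A : H →ₗ[𝕜] H) := by
    refine sup_le (Submodule.span_le.2 fun ψ hψ => ?_) (Submodule.span_le.2 fun ψ hψ => ?_)
    · exact Submodule.mem_sup_left (Submodule.subset_span (hac hψ))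
    · exact Submodule.mem_sup_right (Submodule.subset_span (hsc hψ))
  exact key

/-- The restriction of `A` to its continuous subspace. -/
def contPart (A : H →L[𝕜] H) : contSubspace A →L[𝕜] contSubspace A :=
  A.restrict (mapsTo_contSubspace A)

/-- The continuous spectrum `σ_cont(A)`: the spectrum of the restriction of `A` to `H_cont`. -/
def contSpectrum (A : H →L[𝕜] H) : Set 𝕜 :=
  spectrum 𝕜 (contPart A)

end Hilbert

end LECPlastic

end

/-! A nonempty continuous spectrum yields a nonzero vector `ψ` whose spectral measure `ν` has no
atoms. The distribution function of `ν` is then continuous, so its quantiles cut the line into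
arbitrarily many pieces of positive mass (`exists_quantiles`). Continuous bumps on disjoint pieces,
applied to `ψ`, give orthogonal nonzero vectors, so the spectral subspace between any two quantiles
is infinite-dimensional (`IsRealCalculus.not_finiteDimensional_specSub`).

Choose a two-sided increasing sequence of such intervals with gaps between them. Their spectral
subspaces `G n` are mutually orthogonal and, by separability, all isometric. Hence there is a
unitary `U` that carries `G n` onto `G (n + 1)` and fixes the orthogonal complement of their span
(`exists_unitary_shift`). As `U` moves vectors up the spectrum and `t ↦ t ^ (-1/2)` decreases, `R =
A ^ (-1/2)` satisfies `‖R (U y)‖ ≤ ‖R y‖`, strictly for nonzero `y ∈ G 0`.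

With `S = A ^ (1/2)`, the ellipsoid is the preimage of the unit ball under `S`, so `T = R U S` maps
it bijectively onto itself. Moreover `‖T x‖ = ‖R (U (S x))‖ ≤ ‖R (S x)‖ = ‖x‖`, with strict
inequality somewhere. -/

noncomputable section

namespace LECPlastic

/-! ### Hilbert bases and unitaries glued from orthogonal summands -/

section HilbertSums

variable {𝕜 : Type*} [RCLike 𝕜] {H : Type*} [NormedAddCommGroup H] [InnerProductSpace 𝕜 H]

/-- An orthonormal set in a separable inner product space is countable. -/
theorem countable_of_orthonormal [TopologicalSpace.SeparableSpace H] {w : Set H}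
    (hw : Orthonormal 𝕜 ((↑) : w → H)) : Countable w := by
  have : DiscreteTopology w := by
    refine DiscreteTopology.of_forall_le_dist one_pos fun x y hxy => ?_
    have h0 : inner 𝕜 (x : H) (y : H) = 0 := hw.2 hxy
    have h1 := norm_sub_sq (𝕜 := 𝕜) (x : H) (y : H)
    rw [h0, hw.1 x, hw.1 y] at h1
    simp only [map_zero] at h1
    change 1 ≤ dist (x : H) y
    rw [dist_eq_norm]
    nlinarith [norm_nonneg ((x : H) - y)]
  exact (TopologicalSpace.separableSpace_iff_countable).1 inferInstance

/-- A separable infinite-dimensional Hilbert space has a Hilbert basis indexed by `ℕ`. -/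
theorem exists_nat_hilbertBasis [CompleteSpace H] [TopologicalSpace.SeparableSpace H]
    (hdim : ¬ FiniteDimensional 𝕜 H) : Nonempty (HilbertBasis ℕ 𝕜 H) := by
  obtain ⟨w, b, hb⟩ := exists_hilbertBasis 𝕜 H
  have hon : Orthonormal 𝕜 ((↑) : w → H) := hb ▸ b.orthonormal
  have : Countable w := countable_of_orthonormal hon
  have : Infinite w := by
    by_contra hfin
    rw [not_infinite_iff_finite] at hfin
    have := Fintype.ofFinite w
    exact hdim b.toOrthonormalBasis.toBasis.finiteDimensional_of_finite
  obtain ⟨u⟩ := nonempty_equiv_of_countable (α := ℕ) (β := w)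
  refine ⟨HilbertBasis.mk (b.orthonormal.comp u u.injective) ?_⟩
  rw [u.surjective.range_comp, b.dense_span]

theorem nonempty_linearIsometryEquiv {E F : Type*} [NormedAddCommGroup E]
    [InnerProductSpace 𝕜 E] [NormedAddCommGroup F] [InnerProductSpace 𝕜 F]
    [CompleteSpace E] [CompleteSpace F] [TopologicalSpace.SeparableSpace E]
    [TopologicalSpace.SeparableSpace F] (hE : ¬ FiniteDimensional 𝕜 E)
    (hF : ¬ FiniteDimensional 𝕜 F) : Nonempty (E ≃ₗᵢ[𝕜] F) := by
  obtain ⟨b⟩ := exists_nat_hilbertBasis hE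
  obtain ⟨c⟩ := exists_nat_hilbertBasis hF
  exact ⟨b.repr.trans c.repr.symm⟩

variable {ι : Type*} {F : ι → Submodule 𝕜 H}

/-- Isometries between the summands of a Hilbert sum that permute these summands are glued to a
unitary operator. -/
theorem exists_unitary_of_perm [CompleteSpace H] [∀ i, CompleteSpace (F i)]
    (hF : OrthogonalFamily 𝕜 (fun i => F i) fun i => (F i).subtypeₗᵢ)
    (htot : ⊤ ≤ (⨆ i, F i).topologicalClosure) (τ : Equiv.Perm ι)
    (e : ∀ i, F i ≃ₗᵢ[𝕜] F (τ i)) :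
    ∃ U : H ≃ₗᵢ[𝕜] H, ∀ i (x : F i), U x = e i x := by
  classical
  have h1 := IsHilbertSum.mkInternal F hF htot
  let V : ∀ i, F i →ₗᵢ[𝕜] H := fun i => (F (τ i)).subtypeₗᵢ.comp (e i).toLinearIsometry
  have hV : OrthogonalFamily 𝕜 (fun i => F i) V := fun i j hij x y =>
    hF (τ.injective.ne hij) (e i x) (e j y)
  have hr : ∀ i, F (τ i) ≤ LinearMap.range (V i).toLinearMap := fun i x hx =>
    ⟨(e i).symm ⟨x, hx⟩, by simp [V]⟩
  have h2 : IsHilbertSum 𝕜 (fun i => F i) V := by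
    refine IsHilbertSum.mk hV (htot.trans (Submodule.topologicalClosure_mono ?_))
    refine iSup_le fun i => ?_
    have := (hr (τ.symm i)).trans (le_iSup (fun i => LinearMap.range (V i).toLinearMap) _)
    rwa [τ.apply_symm_apply] at this
  -- The same ℓ² sum is identified with `H` twice, through the inclusions and through `V`; `U` is
  -- the change of identification.
  refine ⟨h1.linearIsometryEquiv.trans h2.linearIsometryEquiv.symm, fun i x => ?_⟩
  have hx : h1.linearIsometryEquiv (x : H) = lp.single 2 i x := by
    rw [← LinearIsometryEquiv.eq_symm_apply, h1.linearIsometryEquiv_symm_apply_single]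
    rfl
  rw [LinearIsometryEquiv.trans_apply, hx, h2.linearIsometryEquiv_symm_apply_single]
  rfl

/-- On finite sums of vectors from the summands, Pythagoras applies to both sides, since `R`
preserves each summand and `U` permutes them. Density and continuity do the rest. -/
theorem norm_apply_unitary_le
    (hF : OrthogonalFamily 𝕜 (fun i => F i) fun i => (F i).subtypeₗᵢ)
    (htot : ⊤ ≤ (⨆ i, F i).topologicalClosure) (τ : Equiv.Perm ι)
    {U : H ≃ₗᵢ[𝕜] H} (hU : ∀ i, ∀ x ∈ F i, U x ∈ F (τ i)) {R : H →L[𝕜] H}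
    (hR : ∀ i, ∀ x ∈ F i, R x ∈ F i) (hle : ∀ i, ∀ x ∈ F i, ‖R (U x)‖ ≤ ‖R x‖) (y : H) :
    ‖R (U y)‖ ≤ ‖R y‖ := by
  classical
  have hcl : IsClosed {y | ‖R (U y)‖ ≤ ‖R y‖} :=
    isClosed_le (R.continuous.comp U.continuous).norm R.continuous.norm
  refine closure_minimal (s := ((⨆ i, F i : Submodule 𝕜 H) : Set H)) (fun z hz => ?_) hcl
    (htot (Submodule.mem_top (x := y)))
  obtain ⟨f, rfl⟩ := (Submodule.mem_iSup_iff_exists_dfinsupp' F z).1 hz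
  have h1 := hF.norm_sum (fun i => ⟨R (f i), hR i _ (f i).2⟩) f.support
  have h2 := (hF.comp τ.injective).norm_sum
    (fun i => ⟨R (U (f i)), hR _ _ (hU i _ (f i).2)⟩) f.support
  simp only [Submodule.coe_subtypeₗᵢ, Submodule.subtype_apply, Submodule.coe_norm] at h1 h2
  change ‖R (U _)‖ ≤ ‖R _‖
  simp only [DFinsupp.sum, map_sum]
  refine le_of_sq_le_sq ?_ (norm_nonneg _)
  rw [h1, h2]
  exact Finset.sum_le_sum fun i _ => pow_le_pow_left₀ (norm_nonneg _) (hle i _ (f i).2) 2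

end HilbertSums

/-! ### Spectral subspaces from a continuous functional calculus -/

section RealCalculus

variable {𝕜 : Type*} [RCLike 𝕜] {H : Type*} [NormedAddCommGroup H] [InnerProductSpace 𝕜 H]

/-- A calculus of real continuous functions of the operator `A`, with symmetric operators as
values. -/
structure IsRealCalculus (A : H →L[𝕜] H) (ρ : C(ℝ, ℝ) →+* (H →L[𝕜] H)) : Prop where
  symm : ∀ u x y, inner 𝕜 (ρ u x) y = inner 𝕜 x (ρ u y)
  map_const : ∀ c x, ρ (ContinuousMap.const ℝ c) x = (c : 𝕜) • x
  map_id : ρ (ContinuousMap.id ℝ) = A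

/-- The spectral subspace of the interval `[a, b]`: the vectors annihilated by all functions that
vanish on the interval. -/
def specSub (ρ : C(ℝ, ℝ) →+* (H →L[𝕜] H)) (a b : ℝ) : Submodule 𝕜 H :=
  ⨅ g : {g : C(ℝ, ℝ) // ∀ t ∈ Set.Icc a b, g t = 0}, LinearMap.ker (ρ g : H →ₗ[𝕜] H)

variable {A : H →L[𝕜] H} {ρ : C(ℝ, ℝ) →+* (H →L[𝕜] H)} {a b : ℝ} {x : H}

theorem mem_specSub :
    x ∈ specSub ρ a b ↔ ∀ g : C(ℝ, ℝ), (∀ t ∈ Set.Icc a b, g t = 0) → ρ g x = 0 := by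
  simp [specSub, Submodule.mem_iInf]

theorem isClosed_specSub : IsClosed (specSub ρ a b : Set H) := by
  rw [specSub, Submodule.coe_iInf]
  exact isClosed_iInter fun g => (ρ g).isClosed_ker

instance [CompleteSpace H] : CompleteSpace (specSub ρ a b) :=
  isClosed_specSub.completeSpace_coe

theorem map_mul_apply' (u v : C(ℝ, ℝ)) (x : H) : ρ (u * v) x = ρ u (ρ v x) := by
  rw [map_mul]; rfl

theorem map_mem_specSub (u : C(ℝ, ℝ)) (hx : x ∈ specSub ρ a b) : ρ u x ∈ specSub ρ a b := by
  rw [mem_specSub] at *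
  intro g hg
  rw [← map_mul_apply', mul_comm, map_mul_apply', hx g hg, map_zero]

theorem apply_mem_specSub (u : C(ℝ, ℝ)) (hu : ∀ t ∉ Set.Icc a b, u t = 0) :
    ρ u x ∈ specSub ρ a b := by
  rw [mem_specSub]
  intro g hg
  have h : g * u = 0 := by
    ext t
    by_cases ht : t ∈ Set.Icc a b
    · simp [hg t ht]
    · simp [hu t ht]
  rw [← map_mul_apply', h, map_zero]
  rfl

namespace IsRealCalculus

variable (h : IsRealCalculus A ρ)
include h

theorem norm_sq_apply (u : C(ℝ, ℝ)) (x : H) :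
    ‖ρ u x‖ ^ 2 = RCLike.re (inner 𝕜 x (ρ (u * u) x)) := by
  rw [map_mul_apply', ← h.symm, ← norm_sq_eq_re_inner]

theorem re_inner_nonneg (u : C(ℝ, ℝ)) (hu : ∀ t, 0 ≤ u t) (x : H) :
    0 ≤ RCLike.re (inner 𝕜 x (ρ u x)) := by
  have hsq : u = (⟨fun t => √(u t), by fun_prop⟩ : C(ℝ, ℝ)) * ⟨fun t => √(u t), by fun_prop⟩ := by
    ext t
    exact (Real.mul_self_sqrt (hu t)).symm
  rw [hsq, ← h.norm_sq_apply]
  positivity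

/-- The part of `u² - v²` that is positive vanishes on `[a, b]`, so it annihilates `x`; what remains
of `v² - u²` is nonnegative on the whole line. -/
theorem norm_apply_le_of_abs_le (hx : x ∈ specSub ρ a b) {u v : C(ℝ, ℝ)}
    (huv : ∀ t ∈ Set.Icc a b, |u t| ≤ |v t|) : ‖ρ u x‖ ≤ ‖ρ v x‖ := by
  refine le_of_sq_le_sq ?_ (norm_nonneg _)
  rw [h.norm_sq_apply, h.norm_sq_apply]
  have hdec : v * v + ((u * u - v * v) ⊔ 0) = u * u + ((v * v - u * u) ⊔ 0) := by
    ext t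
    simp only [ContinuousMap.add_apply, ContinuousMap.mul_apply, ContinuousMap.sup_apply,
      ContinuousMap.sub_apply, ContinuousMap.zero_apply]
    rcases le_total (u t * u t) (v t * v t) with h1 | h1
    · rw [max_eq_right (by linarith), max_eq_left (by linarith)]; ring
    · rw [max_eq_left (by linarith), max_eq_right (by linarith)]; ring
  have hzero : ρ ((u * u - v * v) ⊔ 0) x = 0 := by
    refine mem_specSub.1 hx _ fun t ht => ?_
    have : u t * u t ≤ v t * v t := by
      simpa only [sq] using sq_le_sq.2 (huv t ht)
    simpa using this
  have heq : ρ (v * v) x = ρ (u * u) x + ρ ((v * v - u * u) ⊔ 0) x := by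
    have := congrArg (fun w => ρ w x) hdec
    simpa [map_add, hzero, -map_mul] using this
  have hn := h.re_inner_nonneg ((v * v - u * u) ⊔ 0) (fun t => by simp) x
  rw [heq, inner_add_right, map_add]
  linarith

theorem inner_eq_zero_of_lt {a' b' : ℝ} {y : H} (hx : x ∈ specSub ρ a b)
    (hy : y ∈ specSub ρ a' b') (hlt : b < a') : inner 𝕜 x y = 0 := by
  -- A ramp from 0 at `b` to 1 at `a'`: it annihilates `x` and fixes `y`.
  let g : C(ℝ, ℝ) := ⟨fun t => max 0 (min 1 ((t - b) / (a' - b))), by fun_prop⟩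
  have hgx : ρ g x = 0 := by
    refine mem_specSub.1 hx _ fun t ht => ?_
    have : (t - b) / (a' - b) ≤ 0 :=
      div_nonpos_of_nonpos_of_nonneg (by linarith [ht.2]) (by linarith)
    exact max_eq_left ((min_le_right _ _).trans this)
  have hgy : ρ (1 - g) y = 0 := by
    refine mem_specSub.1 hy _ fun t ht => ?_
    have : 1 ≤ (t - b) / (a' - b) := by
      rw [le_div_iff₀ (by linarith)]
      linarith [ht.1]
    simp [g, min_eq_left this]
  have hy' : y = ρ g y := by
    rw [map_sub, map_one] at hgy
    exact sub_eq_zero.1 hgy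
  rw [hy', ← h.symm, hgx, inner_zero_left]

/-- A function that vanishes above a lower bound of the quadratic form of `A` is mapped to `0`. -/
theorem map_eq_zero_of_le {c : ℝ} (hc : ∀ x, c * ‖x‖ ^ 2 ≤ RCLike.re (inner 𝕜 (A x) x)) :
    ρ ((ContinuousMap.const ℝ c - ContinuousMap.id ℝ) ⊔ 0) = 0 := by
  set k : C(ℝ, ℝ) := (ContinuousMap.const ℝ c - ContinuousMap.id ℝ) ⊔ 0 with hk
  have hk0 : ∀ t, 0 ≤ k t := fun t => by simp [hk]
  let w : C(ℝ, ℝ) := ⟨fun t => √(k t), by fun_prop⟩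
  have hw : w * w = k := by
    ext t
    exact Real.mul_self_sqrt (hk0 t)
  have h1 : ∀ x, ρ (w * k) x = 0 := fun x => by
    have h2 := hc (ρ k x)
    -- With `k = (c - t)⁺` one has `t k² + k³ = c k²`. Against the lower bound of the form at `ρ k
    -- x`, this leaves no room for the `k³` term.
    have h3 : ContinuousMap.id ℝ * (k * k) + (w * k) * (w * k) =
        ContinuousMap.const ℝ c * (k * k) := by
      rw [mul_mul_mul_comm, hw, ← add_mul]
      ext t
      rcases le_total (c - t) 0 with h4 | h4
      · simp [hk, max_eq_right h4]
      · simp [hk, max_eq_left h4]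
    have h5 := congrArg (fun z => RCLike.re (inner 𝕜 x (ρ z x))) h3
    simp only [map_add, add_apply, inner_add_right] at h5
    rw [← h.norm_sq_apply] at h5
    have h6 : RCLike.re (inner 𝕜 x (ρ (ContinuousMap.id ℝ * (k * k)) x)) =
        RCLike.re (inner 𝕜 (A (ρ k x)) (ρ k x)) := by
      rw [mul_left_comm, map_mul_apply', ← h.symm, map_mul_apply', h.map_id, inner_re_symm]
    have h7 : RCLike.re (inner 𝕜 x (ρ (ContinuousMap.const ℝ c * (k * k)) x)) =
        c * ‖ρ k x‖ ^ 2 := by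
      rw [map_mul_apply', h.map_const, inner_smul_right, RCLike.re_ofReal_mul, h.norm_sq_apply]
    rw [h6, h7] at h5
    have h8 : ‖ρ (w * k) x‖ ^ 2 ≤ 0 := by linarith
    exact norm_eq_zero.1 (pow_eq_zero_iff two_ne_zero |>.1 (le_antisymm h8 (sq_nonneg _)))
  ext x
  have h9 : ‖ρ k x‖ ^ 2 = 0 := by
    rw [h.norm_sq_apply]
    nth_rewrite 1 [← hw]
    rw [mul_assoc, map_mul_apply', h1, map_zero, inner_zero_right, map_zero]
  simpa using h9

end IsRealCalculus

end RealCalculus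

/-! ### Quantiles of atomless measures and bump functions -/

section Quantiles

open Filter Topology

/-- Dominated convergence: the indicators of `Iic s` converge to that of `Iic t` except at the point
`t`, which is null. -/
theorem continuous_measureReal_Iic (ν : Measure ℝ) [IsFiniteMeasure ν] [NullSingletonClass ν] :
    Continuous fun t => ν.real (Set.Iic t) := by
  have h1 : ∀ t, ν.real (Set.Iic t) = ∫ x, (Set.Iic t).indicator (fun _ => (1 : ℝ)) x ∂ν :=
    fun t => by simp [integral_indicator measurableSet_Iic]
  simp only [h1]
  refine continuous_iff_continuousAt.2 fun t => ?_
  refine tendsto_integral_filter_of_dominated_convergence (fun _ => (1 : ℝ))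
    (Eventually.of_forall fun s => ?_) (Eventually.of_forall fun s => ?_)
    (integrable_const _) ?_
  · exact (measurable_const.indicator measurableSet_Iic).aestronglyMeasurable
  · refine Eventually.of_forall fun x => ?_
    by_cases hx : x ∈ Set.Iic s <;> simp [hx]
  · have hne : ∀ᵐ x ∂ν, x ≠ t := by
      simp [ae_iff]
    filter_upwards [hne] with x hx
    refine tendsto_const_nhds.congr' ?_
    rcases lt_or_gt_of_ne hx with hlt | hlt
    · filter_upwards [lt_mem_nhds hlt] with s hs
      simp [hs.le, hlt.le]
    · filter_upwards [gt_mem_nhds hlt] with s hs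
      simp [hs, hlt]

/-- An atomless nonzero finite measure on the line has a strictly increasing quantile function,
with positive mass between any two quantiles. -/
theorem exists_quantiles (ν : Measure ℝ) [IsFiniteMeasure ν] [NullSingletonClass ν] (hν : ν ≠ 0) :
    ∃ c : ℝ → ℝ, ∀ x y, x < y → c x < c y ∧ ν (Set.Ioo (c x) (c y)) ≠ 0 := by
  have hM : 0 < ν.real Set.univ := by
    rw [measureReal_def, ENNReal.toReal_pos_iff]
    exact ⟨by simpa [pos_iff_ne_zero] using hν, measure_lt_top _ _⟩
  have hcont := continuous_measureReal_Iic ν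
  have htop : Tendsto (fun t => ν.real (Set.Iic t)) atTop (𝓝 (ν.real Set.univ)) :=
    (ENNReal.tendsto_toReal (measure_ne_top _ _)).comp (tendsto_measure_Iic_atTop ν)
  have hbot : Tendsto (fun t => ν.real (Set.Iic t)) atBot (𝓝 0) := by
    have h1 := tendsto_measure_iInter_atBot (μ := ν) (s := fun t : ℝ => Set.Iic t)
      (fun t => measurableSet_Iic.nullMeasurableSet) (fun _ _ => Set.Iic_subset_Iic.2)
      ⟨0, measure_ne_top _ _⟩
    have h2 : ⋂ t : ℝ, Set.Iic t = ∅ := Set.eq_empty_of_forall_notMem fun t ht => by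
      have := Set.mem_iInter.1 ht (t - 1)
      rw [Set.mem_Iic] at this
      linarith
    rw [h2, measure_empty] at h1
    exact (ENNReal.tendsto_toReal ENNReal.zero_ne_top).comp h1
  -- The sigmoid takes values strictly between 0 and 1, so each level lies strictly between the
  -- limits of the distribution function and the intermediate value theorem applies.
  have hex : ∀ x : ℝ, ∃ t, ν.real (Set.Iic t) = ν.real Set.univ * Real.sigmoid x := fun x => by
    have h1 : ν.real Set.univ * Real.sigmoid x < ν.real Set.univ :=
      mul_lt_of_lt_one_right hM (Real.sigmoid_lt_one x)
    have h2 : 0 < ν.real Set.univ * Real.sigmoid x := mul_pos hM (Real.sigmoid_pos x)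
    exact mem_range_of_exists_le_of_exists_ge hcont ((hbot.eventually_le_const h2).exists)
      ((htop.eventually_const_le h1).exists)
  choose c hc using hex
  refine ⟨c, fun x y hxy => ?_⟩
  have h1 : ν.real (Set.Iic (c x)) < ν.real (Set.Iic (c y)) := by
    rw [hc, hc]
    exact mul_lt_mul_of_pos_left (Real.sigmoid_strictMono hxy) hM
  refine ⟨lt_of_not_ge fun h2 => h1.not_ge (measureReal_mono (Set.Iic_subset_Iic.2 h2)),
    fun h0 => h1.not_ge ?_⟩
  rw [measure_congr Ioo_ae_eq_Ioc] at h0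
  calc ν.real (Set.Iic (c y)) ≤ ν.real (Set.Iic (c x) ∪ Set.Ioc (c x) (c y)) :=
        measureReal_mono fun t ht => by
          rcases le_or_gt t (c x) with h | h
          · exact Or.inl h
          · exact Or.inr ⟨h, ht⟩
    _ ≤ ν.real (Set.Iic (c x)) + ν.real (Set.Ioc (c x) (c y)) := measureReal_union_le _ _
    _ = ν.real (Set.Iic (c x)) := by simp [measureReal_def, h0]

/-- A continuous function that is positive on the open interval `(a, b)` and vanishes elsewhere. -/
def tent (a b : ℝ) : C(ℝ, ℝ) := ⟨fun t => max 0 (min (t - a) (b - t)), by fun_prop⟩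

theorem tent_eq_zero {a b t : ℝ} (ht : t ∉ Set.Ioo a b) : tent a b t = 0 := by
  refine max_eq_left (not_lt.1 fun h => ht ?_)
  rw [lt_min_iff] at h
  exact ⟨by linarith, by linarith⟩

theorem tent_pos {a b t : ℝ} (ht : t ∈ Set.Ioo a b) : 0 < tent a b t :=
  lt_max_of_lt_right (lt_min (by linarith [ht.1]) (by linarith [ht.2]))

theorem integral_tent_sq_ne_zero {ν : Measure ℝ} [IsFiniteMeasure ν] {a b : ℝ} (hab : a < b)
    (hν : ν (Set.Ioo a b) ≠ 0) : ∫ t, tent a b t ^ 2 ∂ν ≠ 0 := by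
  intro h
  have hint : Integrable (fun t => tent a b t ^ 2) ν := by
    refine Integrable.of_bound (by fun_prop) ((b - a) ^ 2) (Eventually.of_forall fun t => ?_)
    have h1 : 0 ≤ tent a b t := le_max_left _ _
    have h2 : tent a b t ≤ b - a := by
      refine max_le (by linarith) ?_
      rcases le_total t b with htb | htb
      · exact (min_le_left _ _).trans (by linarith)
      · exact (min_le_right _ _).trans (by linarith)
    rw [Real.norm_of_nonneg (by positivity)]
    gcongr
  rw [integral_eq_zero_iff_of_nonneg (fun t => sq_nonneg _) hint] at h
  refine hν (measure_mono_null (fun t ht => ?_) (ae_iff.1 h))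
  exact (pow_pos (tent_pos ht) 2).ne'

end Quantiles

/-! ### From the spectral measure to the real calculus -/

section SpectralMeasure

variable {𝕜 : Type*} [RCLike 𝕜] {H : Type*} [NormedAddCommGroup H] [InnerProductSpace 𝕜 H]

/-- The restriction of real functions to the spectrum of `A`. -/
def toSpectrum (A : H →L[𝕜] H) : C(ℝ, ℝ) →+* C(realSpectrum A, 𝕜) where
  toFun u := ⟨fun t => (u t : 𝕜), RCLike.continuous_ofReal.comp (by fun_prop)⟩
  map_one' := by ext; simp
  map_mul' u v := by ext; simp
  map_zero' := by ext; simp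
  map_add' u v := by ext; simp

variable [CompleteSpace H]

theorem IsFunctionalCalculus.isRealCalculus {A : H →L[𝕜] H}
    {φ : C(realSpectrum A, 𝕜) →⋆ₐ[𝕜] (H →L[𝕜] H)} (hφ : IsFunctionalCalculus A φ) :
    IsRealCalculus A ((φ : C(realSpectrum A, 𝕜) →+* (H →L[𝕜] H)).comp (toSpectrum A)) where
  symm u x y := by
    have hstar : star (toSpectrum A u) = toSpectrum A u := by
      ext t
      simp [toSpectrum]
    change inner 𝕜 (φ (toSpectrum A u) x) y = inner 𝕜 x (φ (toSpectrum A u) y)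
    rw [← ContinuousLinearMap.adjoint_inner_left, ← ContinuousLinearMap.star_eq_adjoint,
      ← map_star, hstar]
  map_const c x := by
    have : toSpectrum A (ContinuousMap.const ℝ c) =
        algebraMap 𝕜 C(realSpectrum A, 𝕜) (c : 𝕜) := by
      ext t
      simp [toSpectrum]
    change φ (toSpectrum A _) x = _
    rw [this, AlgHomClass.commutes, ContinuousLinearMap.algebraMap_apply]
  map_id := hφ.map_id

theorem IsSpectralMeasure.exists_realCalculus {A : H →L[𝕜] H} {ψ : H}
    {μ : Measure (realSpectrum A)} (hμ : IsSpectralMeasure A ψ μ) :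
    ∃ ρ : C(ℝ, ℝ) →+* (H →L[𝕜] H), IsRealCalculus A ρ ∧
      ∀ u, ‖ρ u ψ‖ ^ 2 = ∫ t, u t ^ 2 ∂μ.map (Subtype.val : realSpectrum A → ℝ) := by
  obtain ⟨hfin, φ, hφ, hint⟩ := hμ
  refine ⟨_, hφ.isRealCalculus, fun u => ?_⟩
  rw [hφ.isRealCalculus.norm_sq_apply]
  change RCLike.re (inner 𝕜 ψ (φ (toSpectrum A (u * u)) ψ)) = _
  rw [hint, integral_map (by fun_prop) (by fun_prop)]
  have : ∀ t, toSpectrum A (u * u) t = ((u t ^ 2 : ℝ) : 𝕜) := fun t => by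
    simp [toSpectrum, sq]
  simp only [this]
  rw [integral_ofReal, RCLike.ofReal_re]

end SpectralMeasure

/-! ### Infinite dimension of the spectral subspaces -/

section InfiniteDimensional

variable {𝕜 : Type*} [RCLike 𝕜] {H : Type*} [NormedAddCommGroup H] [InnerProductSpace 𝕜 H]
  {A : H →L[𝕜] H} {ρ : C(ℝ, ℝ) →+* (H →L[𝕜] H)}

theorem IsRealCalculus.not_finiteDimensional_specSub (h : IsRealCalculus A ρ) {ψ : H}
    {c : ℝ → ℝ} (hc : ∀ x y, x < y → c x < c y ∧ ρ (tent (c x) (c y)) ψ ≠ 0) {x y : ℝ}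
    (hxy : x < y) : ¬ FiniteDimensional 𝕜 (specSub ρ (c x) (c y)) := by
  intro hfin
  have hmono : StrictMono c := fun x y hxy => (hc x y hxy).1
  -- A strictly increasing sequence in `[x, y)`; consecutive terms bound disjoint intervals of
  -- quantiles inside `[c x, c y]`.
  let p : ℕ → ℝ := fun n => y - (y - x) / (n + 1)
  have hp : StrictMono p := fun m n hmn => by
    have h1 : (m : ℝ) < n := by exact_mod_cast hmn
    have h2 : 0 < y - x := sub_pos.2 hxy
    have : (y - x) / ((n : ℝ) + 1) < (y - x) / (m + 1) := by gcongr
    simp only [p]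
    linarith
  have hpx : ∀ n, x ≤ p n := fun n => by
    have := div_le_self (sub_pos.2 hxy).le (by simp : (1 : ℝ) ≤ n + 1)
    simp only [p]
    linarith
  have hpy : ∀ n, p n ≤ y := fun n => by
    have : 0 ≤ (y - x) / ((n : ℝ) + 1) := div_nonneg (sub_pos.2 hxy).le (by positivity)
    simp only [p]
    linarith
  let v : ℕ → specSub ρ (c x) (c y) := fun n =>
    ⟨ρ (tent (c (p n)) (c (p (n + 1)))) ψ, apply_mem_specSub _ fun t ht => tent_eq_zero fun ht' =>
      ht ⟨(hmono.monotone (hpx n)).trans ht'.1.le, ht'.2.le.trans (hmono.monotone (hpy _))⟩⟩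
  have hlt : ∀ m n, m < n → inner 𝕜 (v m) (v n) = 0 := fun m n hmn => by
    have hle : c (p (m + 1)) ≤ c (p n) := hmono.monotone (hp.monotone hmn)
    have hz : tent (c (p m)) (c (p (m + 1))) * tent (c (p n)) (c (p (n + 1))) = 0 := by
      ext t
      rcases le_or_gt (c (p (m + 1))) t with ht | ht
      · simp [tent_eq_zero (a := c (p m)) (fun h' => h'.2.not_ge ht)]
      · simp [tent_eq_zero (b := c (p (n + 1))) (fun h' => h'.1.not_ge (ht.le.trans hle))]
    change inner 𝕜 (ρ _ ψ) (ρ _ ψ) = 0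
    rw [h.symm, ← map_mul_apply', hz, map_zero]
    exact inner_zero_right _
  have hli : LinearIndependent 𝕜 v := by
    refine linearIndependent_of_ne_zero_of_inner_eq_zero (fun n hn => ?_) fun m n hmn => ?_
    · exact (hc _ _ (hp n.lt_succ_self)).2 (congrArg Subtype.val hn)
    · rcases lt_or_gt_of_ne hmn with hmn | hmn
      · exact hlt m n hmn
      · exact inner_eq_zero_symm.1 (hlt n m hmn)
  exact not_finite_iff_infinite.2 (inferInstance : Infinite ℕ) hli.finite

end InfiniteDimensional

/-! ### The unitary shift -/

section Shift

variable {𝕜 : Type*} [RCLike 𝕜] {H : Type*} [NormedAddCommGroup H] [InnerProductSpace 𝕜 H]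

/-- A family of subspaces together with the orthogonal complement of their span. -/
def withComplement {ι : Type*} (G : ι → Submodule 𝕜 H) : Option ι → Submodule 𝕜 H
  | none => (⨆ n, G n)ᗮ
  | some n => G n

theorem orthogonalFamily_withComplement {ι : Type*} {G : ι → Submodule 𝕜 H}
    (hG : ∀ m n, m ≠ n → ∀ x ∈ G m, ∀ y ∈ G n, inner 𝕜 x y = 0) :
    OrthogonalFamily 𝕜 (fun i => withComplement G i)
      fun i => (withComplement G i).subtypeₗᵢ := by
  have hle : ∀ n, ∀ x ∈ G n, ∀ y ∈ (⨆ n, G n)ᗮ, inner 𝕜 x y = 0 := fun n x hx y hy =>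
    (Submodule.mem_orthogonal _ _).1 hy x (Submodule.mem_iSup_of_mem n hx)
  rintro (_ | m) (_ | n) hmn x y
  · exact absurd rfl hmn
  · exact inner_eq_zero_symm.1 (hle n y y.2 x x.2)
  · exact hle m x x.2 y y.2
  · exact hG m n (fun h => hmn (congrArg some h)) x x.2 y y.2

theorem top_le_closure_withComplement [CompleteSpace H] {ι : Type*} (G : ι → Submodule 𝕜 H) :
    ⊤ ≤ (⨆ i, withComplement G i).topologicalClosure := by
  rw [top_le_iff, Submodule.topologicalClosure_eq_top_iff, eq_bot_iff]
  intro x hx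
  rw [Submodule.mem_orthogonal] at hx
  have hmem : x ∈ withComplement G none := by
    refine (Submodule.mem_orthogonal _ _).2 fun y hy => hx y ?_
    have : (⨆ n, G n) ≤ ⨆ i, withComplement G i :=
      iSup_le fun n => le_iSup (withComplement G) (some n)
    exact this hy
  exact inner_self_eq_zero.1 (hx x (Submodule.mem_iSup_of_mem none hmem))

/-- A unitary operator that shifts a two-sided sequence of mutually orthogonal, isometric
reducing subspaces of `R` on which `R` does not increase. -/
theorem exists_unitary_shift [CompleteSpace H] {G : ℤ → Submodule 𝕜 H}
    [∀ n, CompleteSpace (G n)] (hG : ∀ m n, m ≠ n → ∀ x ∈ G m, ∀ y ∈ G n, inner 𝕜 x y = 0)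
    (e : ∀ n, G n ≃ₗᵢ[𝕜] G (n + 1)) {R : H →L[𝕜] H}
    (hsymm : ∀ x y, inner 𝕜 (R x) y = inner 𝕜 x (R y)) (hR : ∀ n, ∀ x ∈ G n, R x ∈ G n)
    (hle : ∀ n, ∀ x ∈ G n, ∀ y ∈ G (n + 1), ‖x‖ = ‖y‖ → ‖R y‖ ≤ ‖R x‖) :
    ∃ U : H ≃ₗᵢ[𝕜] H, (∀ n, ∀ x ∈ G n, U x ∈ G (n + 1)) ∧ ∀ y, ‖R (U y)‖ ≤ ‖R y‖ := by
  let τ : Equiv.Perm (Option ℤ) := (Equiv.addRight (1 : ℤ)).optionCongr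
  let e' : ∀ i, withComplement G i ≃ₗᵢ[𝕜] withComplement G (τ i) := fun i =>
    match i with
    | none => LinearIsometryEquiv.refl 𝕜 (withComplement G none)
    | some n => e n
  have : ∀ i, CompleteSpace (withComplement G i) := fun i =>
    match i with
    | none => (Submodule.isClosed_orthogonal (⨆ n, G n)).completeSpace_coe
    | some n => inferInstanceAs (CompleteSpace (G n))
  have hF := orthogonalFamily_withComplement hG
  have htot := top_le_closure_withComplement G
  obtain ⟨U, hU⟩ := exists_unitary_of_perm hF htot τ e'
  have hmem : ∀ i, ∀ x ∈ withComplement G i, U x ∈ withComplement G (τ i) := fun i x hx => by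
    rw [hU i ⟨x, hx⟩]
    exact (e' i ⟨x, hx⟩).2
  refine ⟨U, fun n x hx => hmem (some n) x hx, norm_apply_unitary_le hF htot τ hmem ?_ ?_⟩
  · rintro (_ | n) x hx
    · refine (Submodule.mem_orthogonal _ _).2 fun y hy => ?_
      rw [← hsymm]
      refine (Submodule.mem_orthogonal _ _).1 hx _ ?_
      have : (⨆ n, G n) ≤ (⨆ n, G n).comap (R : H →ₗ[𝕜] H) := iSup_le fun n x hx =>
        Submodule.mem_iSup_of_mem n (hR n x hx)
      exact this hy
    · exact hR n x hx
  · rintro (_ | n) x hx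
    · rw [hU none ⟨x, hx⟩]
      exact le_rfl
    · exact hle n x hx _ (hmem (some n) x hx) (U.norm_map x).symm

end Shift

/-! ### A non-isometric contraction of the ellipsoid -/

section Ellipsoid

variable {𝕜 : Type*} [RCLike 𝕜] {H : Type*} [NormedAddCommGroup H] [InnerProductSpace 𝕜 H]

/-- The operator `S⁻¹ U S` with `U` unitary is a bijection of the ellipsoid generated by `S²`. -/
theorem not_isLECPlastic_of_unitary {A S R : H →L[𝕜] H} (hSR : ∀ x, S (R x) = x)
    (hRS : ∀ x, R (S x) = x) (hA : ∀ x, ‖S x‖ ^ 2 = RCLike.re (inner 𝕜 x (A x)))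
    (U : H ≃ₗᵢ[𝕜] H) (hle : ∀ y, ‖R (U y)‖ ≤ ‖R y‖) (hlt : ∃ y, ‖R (U y)‖ < ‖R y‖) :
    ¬ IsLECPlastic 𝕜 (ellipsoid A) := by
  intro hpl
  have hmem : ∀ x, x ∈ ellipsoid A ↔ ‖S x‖ ≤ 1 := fun x => by
    change RCLike.re (inner 𝕜 x (A x)) ≤ 1 ↔ _
    rw [← hA, sq_le_one_iff₀ (norm_nonneg _)]
  let T : H →ₗ[𝕜] H := (R : H →ₗ[𝕜] H) ∘ₗ (U.toLinearEquiv : H →ₗ[𝕜] H) ∘ₗ (S : H →ₗ[𝕜] H)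
  have hT : ∀ x, T x = R (U (S x)) := fun _ => rfl
  have hnorm : ∀ x, ‖T x‖ ≤ ‖x‖ := fun x => by
    rw [hT]
    exact (hle _).trans_eq (by rw [hRS])
  have hbij : Set.BijOn T (ellipsoid A) (ellipsoid A) := by
    refine ⟨fun x hx => ?_, fun x _ y _ hxy => ?_, fun x hx => ?_⟩
    · rw [hmem] at *
      rwa [hT, hSR, U.norm_map]
    · have h1 := congrArg S hxy
      rw [hT, hT, hSR, hSR] at h1
      rw [← hRS x, U.injective h1, hRS]
    · refine ⟨R (U.symm (S x)), ?_, ?_⟩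
      · rw [hmem] at *
        rwa [hSR, U.symm.norm_map]
      · rw [hT, hSR, U.apply_symm_apply, hRS]
  obtain ⟨y, hy⟩ := hlt
  have hy0 : y ≠ 0 := by
    rintro rfl
    simp at hy
  have hyn : (‖y‖ : 𝕜) ≠ 0 := by simpa using hy0
  have h0 : (0 : H) ∈ ellipsoid A := by simp [hmem]
  -- Normalizing `y` puts its image under `R` in the ellipsoid; comparing this point with 0
  -- contradicts the strict inequality at `y`.
  have h1 : R ((‖y‖ : 𝕜)⁻¹ • y) ∈ ellipsoid A := by
    rw [hmem, hSR, norm_smul, norm_inv, RCLike.norm_ofReal, abs_norm,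
      inv_mul_cancel₀ (norm_ne_zero_iff.2 hy0)]
  have h2 := hpl T hbij
    (fun x _ y _ => by rw [dist_eq_norm, dist_eq_norm, ← map_sub]; exact hnorm _) _ h1 _ h0
  rw [map_zero, dist_zero_right, dist_zero_right, hT, hSR, map_smul, map_smul, map_smul,
    norm_smul, norm_smul] at h2
  exact hy.ne (mul_left_cancel₀ (norm_ne_zero_iff.2 (inv_ne_zero hyn)) h2)

/-- The function `t ↦ √(max t c)`. -/
def cutSqrt (c : ℝ) : C(ℝ, ℝ) := ⟨fun t => √(max t c), by fun_prop⟩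

/-- The function `t ↦ 1 / √(max t c)`. -/
def cutInvSqrt {c : ℝ} (hc : 0 < c) : C(ℝ, ℝ) :=
  ⟨fun t => (√(max t c))⁻¹, Continuous.inv₀ (by fun_prop) fun t =>
    (Real.sqrt_pos.2 (lt_max_of_lt_right hc)).ne'⟩

theorem cutInvSqrt_pos {c : ℝ} (hc : 0 < c) (t : ℝ) : 0 < cutInvSqrt hc t :=
  inv_pos.2 (Real.sqrt_pos.2 (lt_max_of_lt_right hc))

theorem cutInvSqrt_anti {c : ℝ} (hc : 0 < c) : Antitone (cutInvSqrt hc) := fun _ _ hst =>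
  inv_anti₀ (Real.sqrt_pos.2 (lt_max_of_lt_right hc)) (Real.sqrt_le_sqrt (max_le_max_right c hst))

theorem cutInvSqrt_lt {c s t : ℝ} (hc : 0 < c) (hst : s < t) (ht : c < t) :
    cutInvSqrt hc t < cutInvSqrt hc s :=
  inv_strictAnti₀ (Real.sqrt_pos.2 (lt_max_of_lt_right hc))
    (Real.sqrt_lt_sqrt (hc.le.trans (le_max_right _ _))
      ((max_lt hst ht).trans_le (le_max_left _ _)))

theorem cutSqrt_mul_cutInvSqrt {c : ℝ} (hc : 0 < c) : cutSqrt c * cutInvSqrt hc = 1 := by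
  ext t
  exact mul_inv_cancel₀ (Real.sqrt_pos.2 (lt_max_of_lt_right hc)).ne'

/-- The correction term is annihilated by the calculus (`map_eq_zero_of_le`), so `ρ (cutSqrt c)` is
a square root of `A`. -/
theorem cutSqrt_mul_self {c : ℝ} (hc : 0 < c) : cutSqrt c * cutSqrt c =
    ContinuousMap.id ℝ + ((ContinuousMap.const ℝ c - ContinuousMap.id ℝ) ⊔ 0) := by
  ext t
  refine (Real.mul_self_sqrt (hc.le.trans (le_max_right _ _))).trans ?_
  change max t c = t + max (c - t) 0
  rcases le_total t c with h | h
  · rw [max_eq_right h, max_eq_left (by linarith)]; ring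
  · rw [max_eq_left h, max_eq_right (by linarith)]; ring

namespace IsRealCalculus

variable {A : H →L[𝕜] H} {ρ : C(ℝ, ℝ) →+* (H →L[𝕜] H)}

theorem norm_const_apply (h : IsRealCalculus A ρ) {k : ℝ} (hk : 0 ≤ k) (x : H) :
    ‖ρ (ContinuousMap.const ℝ k) x‖ = k * ‖x‖ := by
  rw [h.map_const, norm_smul, RCLike.norm_ofReal, abs_of_nonneg hk]

theorem not_isLECPlastic [CompleteSpace H] [TopologicalSpace.SeparableSpace H]
    (h : IsRealCalculus A ρ) {c : ℝ} (hc : 0 < c)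
    (hA : ∀ x, c * ‖x‖ ^ 2 ≤ RCLike.re (inner 𝕜 (A x) x)) {q : ℝ → ℝ} (hq : StrictMono q)
    (hdim : ∀ x y, x < y → ¬ FiniteDimensional 𝕜 (specSub ρ (q x) (q y))) :
    ¬ IsLECPlastic 𝕜 (ellipsoid A) := by
  -- Stopping at `n + 1 / 2` leaves a gap before the next interval, as orthogonality requires.
  let G : ℤ → Submodule 𝕜 H := fun n => specSub ρ (q n) (q (n + 1 / 2))
  have hlt1 : ∀ n : ℤ, (n : ℝ) < n + 1 / 2 := fun n => by linarith
  have hlt2 : ∀ m n : ℤ, m < n → q ((m : ℝ) + 1 / 2) < q n := fun m n hmn => hq (by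
    have : (m : ℝ) + 1 ≤ n := by exact_mod_cast hmn
    linarith)
  have hGdim : ∀ n, ¬ FiniteDimensional 𝕜 (G n) := fun n => hdim _ _ (hlt1 n)
  have : ∀ n, CompleteSpace (G n) := fun n => inferInstanceAs (CompleteSpace (specSub _ _ _))
  have hG : ∀ m n, m ≠ n → ∀ x ∈ G m, ∀ y ∈ G n, inner 𝕜 x y = 0 := fun m n hmn x hx y hy => by
    rcases lt_or_gt_of_ne hmn with hmn | hmn
    · exact h.inner_eq_zero_of_lt hx hy (hlt2 m n hmn)
    · exact inner_eq_zero_symm.1 (h.inner_eq_zero_of_lt hy hx (hlt2 n m hmn))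
  have hupper : ∀ n, ∀ x ∈ G n, ‖ρ (cutInvSqrt hc) x‖ ≤ cutInvSqrt hc (q n) * ‖x‖ :=
    fun n x hx => by
      rw [← h.norm_const_apply (cutInvSqrt_pos hc _).le]
      refine h.norm_apply_le_of_abs_le hx fun t ht => ?_
      exact abs_le_abs_of_nonneg (cutInvSqrt_pos hc t).le (cutInvSqrt_anti hc ht.1)
  have hlower : ∀ n : ℤ, ∀ x ∈ G n,
      cutInvSqrt hc (q (n + 1 / 2)) * ‖x‖ ≤ ‖ρ (cutInvSqrt hc) x‖ := fun n x hx => by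
    rw [← h.norm_const_apply (cutInvSqrt_pos hc _).le]
    refine h.norm_apply_le_of_abs_le hx fun t ht => ?_
    exact abs_le_abs_of_nonneg (cutInvSqrt_pos hc _).le (cutInvSqrt_anti hc ht.2)
  obtain ⟨U, hU, hle⟩ := exists_unitary_shift hG
    (fun n => (nonempty_linearIsometryEquiv (hGdim n) (hGdim (n + 1))).some)
    (h.symm (cutInvSqrt hc)) (fun n x hx => map_mem_specSub _ hx) (fun n x hx y hy hxy => by
      refine (hupper _ y hy).trans (le_trans ?_ (hlower n x hx))
      rw [hxy]
      exact mul_le_mul_of_nonneg_right (cutInvSqrt_anti hc (hlt2 n (n + 1) (by lia)).le)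
        (norm_nonneg _))
  have hone : ∀ x, ρ 1 x = x := fun x => by rw [map_one]; rfl
  have hzero := h.map_eq_zero_of_le hA
  refine not_isLECPlastic_of_unitary (S := ρ (cutSqrt c)) (R := ρ (cutInvSqrt hc))
    (fun x => ?_) (fun x => ?_) (fun x => ?_) U hle ?_
  · rw [← map_mul_apply', cutSqrt_mul_cutInvSqrt, hone]
  · rw [← map_mul_apply', mul_comm, cutSqrt_mul_cutInvSqrt, hone]
  · rw [h.norm_sq_apply, cutSqrt_mul_self hc, map_add, hzero, add_zero, h.map_id]
  · obtain ⟨y, hy, hy0⟩ : ∃ y ∈ G 0, y ≠ 0 := by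
      refine (Submodule.ne_bot_iff _).1 fun hbot => hGdim 0 ?_
      rw [hbot]
      infer_instance
    have h1 := hlt2 0 (0 + 1) (by lia)
    -- `cutInvSqrt` is constant below `c`, so strictness needs `q 1 > c`. Otherwise the interval of
    -- `G 0` would lie strictly below `c`, where `(c - t)⁺` is bounded away from 0 although its
    -- operator is 0.
    have hcq : c < q ((0 + 1 : ℤ) : ℝ) := by
      by_contra! hqc
      have hpos := sub_pos.2 (h1.trans_le hqc)
      have h2 : ‖ρ (ContinuousMap.const ℝ (c - q ((0 : ℤ) + 1 / 2))) y‖ ≤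
          ‖ρ ((ContinuousMap.const ℝ c - ContinuousMap.id ℝ) ⊔ 0) y‖ :=
        h.norm_apply_le_of_abs_le hy fun t ht =>
          abs_le_abs_of_nonneg hpos.le (le_max_of_le_left (sub_le_sub_left ht.2 c))
      rw [hzero, h.norm_const_apply hpos.le] at h2
      simp only [zero_apply, norm_zero] at h2
      exact h2.not_gt (mul_pos hpos (norm_pos_iff.2 hy0))
    refine ⟨y, (hupper _ _ (hU 0 y hy)).trans_lt (lt_of_lt_of_le ?_ (hlower 0 y hy))⟩
    rw [U.norm_map]
    exact mul_lt_mul_of_pos_right (cutInvSqrt_lt hc h1 hcq) (norm_pos_iff.2 hy0)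

end IsRealCalculus

end Ellipsoid

/-! ### Lower bound of the form and a vector without atoms -/

section ContinuousVector

variable {𝕜 : Type*} [RCLike 𝕜] {H : Type*} [NormedAddCommGroup H] [InnerProductSpace 𝕜 H]

theorem exists_lower_bound_of_iInf_pos {A : H →L[𝕜] H}
    (hpos : 0 < ⨅ x : Metric.sphere (0 : H) 1, RCLike.re (inner 𝕜 (A (x : H)) (x : H))) :
    ∃ c : ℝ, 0 < c ∧ ∀ x, c * ‖x‖ ^ 2 ≤ RCLike.re (inner 𝕜 (A x) x) := by
  refine ⟨_, hpos, fun x => ?_⟩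
  have hbdd : BddBelow (Set.range fun x : Metric.sphere (0 : H) 1 =>
      RCLike.re (inner 𝕜 (A (x : H)) (x : H))) := by
    -- The infimum of a real family unbounded below is 0 by convention, which positivity excludes.
    by_contra hb
    exact hpos.ne' (Real.iInf_of_not_bddBelow hb)
  rcases eq_or_ne x 0 with rfl | hx
  · simp
  · have hx0 := norm_ne_zero_iff.2 hx
    have hu : (‖x‖ : 𝕜)⁻¹ • x ∈ Metric.sphere (0 : H) 1 := by
      rw [mem_sphere_zero_iff_norm, norm_smul, norm_inv, RCLike.norm_ofReal, abs_norm,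
        inv_mul_cancel₀ hx0]
    have h1 := ciInf_le hbdd ⟨_, hu⟩
    have h2 : RCLike.re (inner 𝕜 (A ((‖x‖ : 𝕜)⁻¹ • x)) ((‖x‖ : 𝕜)⁻¹ • x)) =
        RCLike.re (inner 𝕜 (A x) x) / ‖x‖ ^ 2 := by
      rw [← RCLike.ofReal_inv, map_smul, inner_smul_left, inner_smul_right, RCLike.conj_ofReal,
        RCLike.re_ofReal_mul, RCLike.re_ofReal_mul]
      field_simp
    simp only [h2] at h1
    rwa [le_div_iff₀ (by positivity)] at h1

variable [CompleteSpace H]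

/-- If the continuous spectrum is nonempty, then some nonzero vector has an atomless spectral
measure. -/
theorem exists_atomless_of_contSpectrum_nonempty {A : H →L[𝕜] H}
    (hcont : (contSpectrum A).Nonempty) :
    ∃ (ψ : H) (μ : Measure (realSpectrum A)), ψ ≠ 0 ∧ IsSpectralMeasure A ψ μ ∧
      NullSingletonClass (μ.map (Subtype.val : realSpectrum A → ℝ)) := by
  by_contra! hno
  have hzero : ∀ ψ ∈ acVectors A ∪ scVectors A, ψ = 0 := by
    intro ψ hψ
    by_contra hne
    rcases hψ with ⟨μ, hμ, hac⟩ | ⟨μ, hμ, hat, -⟩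
    · exact hno ψ μ hne hμ ⟨fun t => hac (measure_singleton t)⟩
    · exact hno ψ μ hne hμ ⟨hat⟩
  have hbot : contSubspace A = ⊥ := by
    rw [contSubspace, ← Submodule.span_union, Submodule.span_eq_bot]
    exact hzero
  have : Subsingleton (contSubspace A) := (Submodule.subsingleton_iff_eq_bot).2 hbot
  have : Subsingleton (contSubspace A →L[𝕜] contSubspace A) :=
    ⟨fun f g => ContinuousLinearMap.ext fun x => Subsingleton.elim _ _⟩
  obtain ⟨t, ht⟩ := hcont
  -- Over the zero space the operator algebra is trivial, so every spectrum is empty.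
  rw [contSpectrum, spectrum.of_subsingleton] at ht
  exact ht

end ContinuousVector

end LECPlastic
end

theorem corollary3p3 {𝕜 : Type*} [RCLike 𝕜] {H : Type*} [NormedAddCommGroup H]
    [InnerProductSpace 𝕜 H] [CompleteSpace H] [TopologicalSpace.SeparableSpace H]
    (A : H →L[𝕜] H) (hA : IsSelfAdjoint A)
    (hpos : 0 < ⨅ x : Metric.sphere (0 : H) 1, RCLike.re (inner 𝕜 (A (x : H)) (x : H)))
    (hcont : (LECPlastic.contSpectrum A).Nonempty) :
    ¬ LECPlastic.IsLECPlastic 𝕜 (LECPlastic.ellipsoid A) := by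
  obtain ⟨c, hc, hAc⟩ := LECPlastic.exists_lower_bound_of_iInf_pos hpos
  obtain ⟨ψ, μ, hψ, hμ, hν⟩ := LECPlastic.exists_atomless_of_contSpectrum_nonempty hcont
  obtain ⟨ρ, hρ, hint⟩ := hμ.exists_realCalculus
  have := hμ.finite
  set ν := μ.map (Subtype.val : LECPlastic.realSpectrum A → ℝ)
  -- The constant function 1 gives `‖ψ‖ ^ 2` as the total mass of `ν`.
  have hν0 : ν ≠ 0 := fun h0 => hψ (by
    have h1 := hint 1
    rw [h0, integral_zero_measure, map_one] at h1
    simpa using h1)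
  obtain ⟨q, hq⟩ := LECPlastic.exists_quantiles ν hν0
  refine hρ.not_isLECPlastic hc hAc (q := q) (fun x y hxy => (hq x y hxy).1) fun x y hxy =>
    hρ.not_finiteDimensional_specSub (ψ := ψ) (fun x y hxy => ⟨(hq x y hxy).1, fun h0 => ?_⟩) hxy
  refine LECPlastic.integral_tent_sq_ne_zero (hq x y hxy).1 (hq x y hxy).2 ?_
  rw [← hint, h0, norm_zero, sq, zero_mul]
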